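/- Let $G$ be a finite group and let $S=(\mathcal X,\mathcal Y)$ be a supercharacter theory of $G$: $\mathcal X$ is a partition of the set $\mathrm{Irr}(G)$ of irreducible complex characters, $\mathcal Y$ is a partition of $G$ with $\{1\}\in\mathcal Y$ and $|\mathcal X|=|\mathcal Y|$, and for each $X\in\mathcal X$ the supercharacter $\sigma_X=\sum_{\chi\in X}\chi(1)\chi$ is constant on each $K\in\mathcal Y$. For $g\in G$ let $\mathrm{Cl}_S(g)$ be the member of $\mathcal Y$ containing $g$. Put $Z(S)=\{g\in G: |\mathrm{Cl}_S(g)|=1\}$, $[G,S]=\langle g^{-1}k : g\in G,\ k\in \mathrm{Cl}_S(g)\rangle$, and $\|X\|^2=\sum_{\chi\in X}\chi(1)^2$ with $\|X\|\ge 0$. Let $\mathrm{Irr}(S)=\{\sigma_X: X\in\mathcal X\}$ and let $\mathrm{Irr}(S\mid[G,S])$ be the set of those $\sigma\in\mathrm{Irr}(S)$ whose kernel $\{g\in G:\sigma(g)=\sigma(1)\}$ does not contain $[G,S]$; these are called the nonlinear supercharacters. Let $\mathrm{scd}(S)=\{\sigma(1):\sigma\in\mathrm{Irr}(S)\}$.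 Suppose that $G$ is a $VZ(S)$-group, i.e. every $\sigma\in\mathrm{Irr}(S\mid[G,S])$ vanishes on $G\setminus Z(S)$. Then $Z(S)$ is a subgroup of $G$; for every $X\in\mathcal X$ with $\sigma_X$ nonlinear, $$\sigma_X(1)=\|X\|\sqrt{|G:Z(S)|};$$ and $$\mathrm{scd}(S)=\{1\}\cup\left\{\|X\|\sqrt{|G:Z(S)|} : X\in\mathcal X,\ \sigma_X \text{ nonlinear}\right\}.$$ -/

import Mathlib

/-- `Irr(G)`: the set of characters of the irreducible finite-dimensional complex
representations of `G`, as functions `G → ℂ`. -/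
def IrrChar (G : Type*) [Group G] : Set (G → ℂ) :=
  {χ | ∃ (V : Type) (_ : AddCommGroup V) (_ : Module ℂ V) (_ : FiniteDimensional ℂ V)
    (ρ : Representation ℂ G V), ρ.IsIrreducible ∧ χ = ρ.character}

/-- The irreducible characters are orthonormal (for the symmetric form with `g⁻¹`). -/
theorem IrrChar.orthonormal {G : Type*} [Group G] [Fintype G] {χ ψ : G → ℂ}
    (hχ : χ ∈ IrrChar G) (hψ : ψ ∈ IrrChar G) :
    ((Nat.card G : ℂ)⁻¹ * ∑ g : G, χ g * ψ g⁻¹ = 1 ∧ χ = ψ) ∨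
      ((Nat.card G : ℂ)⁻¹ * ∑ g : G, χ g * ψ g⁻¹ = 0) := by
  obtain ⟨V, _, _, _, ρ, hρ, rfl⟩ := hχ
  obtain ⟨W, _, _, _, τ, hτ, rfl⟩ := hψ
  have : Invertible (Nat.card G : ℂ) := invertibleOfNonzero (by simp)
  have h := Representation.char_orthonormal ρ τ
  by_cases hn : Nonempty (Representation.Equiv τ ρ)
  · left
    rw [if_pos hn] at h
    exact ⟨h, (Representation.char_iso hn.some).symm⟩
  · right
    rw [if_neg hn] at h
    exact h

/-- A finite group has only finitely many irreducible characters, so the sums over sets of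
irreducible characters below are finite sums. -/
instance IrrChar.finite (G : Type*) [Group G] [Finite G] : Finite (IrrChar G) := by
  classical
  have := Fintype.ofFinite G
  have hself : ∀ χ ∈ IrrChar G, (Nat.card G : ℂ)⁻¹ * ∑ g : G, χ g * χ g⁻¹ = 1 := by
    rintro χ ⟨V, _, _, _, ρ, hρ, rfl⟩
    have : Invertible (Nat.card G : ℂ) := invertibleOfNonzero (by simp)
    have h := Representation.char_orthonormal ρ ρ
    rwa [if_pos ⟨Representation.Equiv.refl ρ⟩] at h
  have hli : LinearIndependent ℂ (fun χ : IrrChar G => (χ : G → ℂ)) := by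
    rw [linearIndependent_iff']
    intro s a hs ψ hψ
    have h1 : (Nat.card G : ℂ)⁻¹ *
        ∑ g : G, (∑ χ ∈ s, a χ • (χ : G → ℂ)) g * (ψ : G → ℂ) g⁻¹ = 0 := by
      rw [hs]; simp
    have h2 : (Nat.card G : ℂ)⁻¹ *
        ∑ g : G, (∑ χ ∈ s, a χ • (χ : G → ℂ)) g * (ψ : G → ℂ) g⁻¹ =
        ∑ χ ∈ s, a χ * ((Nat.card G : ℂ)⁻¹ *
          ∑ g : G, (χ : G → ℂ) g * (ψ : G → ℂ) g⁻¹) := by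
      simp only [Finset.sum_apply, Pi.smul_apply, smul_eq_mul, Finset.sum_mul, Finset.mul_sum]
      rw [Finset.sum_comm]
      refine Finset.sum_congr rfl fun χ _ => Finset.sum_congr rfl fun g _ => ?_
      ring
    rw [h2, Finset.sum_eq_single ψ] at h1
    · rwa [hself ψ ψ.2, mul_one] at h1
    · intro χ _ hne
      rcases IrrChar.orthonormal χ.2 ψ.2 with h | h
      · exact absurd (Subtype.ext h.2) hne
      · rw [h, mul_zero]
    · exact fun h => absurd hψ h
  exact hli.finite

/-- `σ_X = ∑_{χ ∈ X} χ(1) χ` for a set `X` of irreducible characters. -/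
noncomputable def superchar {G : Type*} [Group G] (X : Set (IrrChar G)) : G → ℂ :=
  fun g => ∑ᶠ χ ∈ X, (χ : G → ℂ) 1 * (χ : G → ℂ) g

/-- `‖X‖ = √(∑_{χ ∈ X} χ(1)²)`; note that `χ(1)` is a positive integer, so that
`|χ(1)|² = χ(1)²`. -/
noncomputable def partNorm {G : Type*} [Group G] (X : Set (IrrChar G)) : ℝ :=
  Real.sqrt (∑ᶠ χ ∈ X, ‖(χ : G → ℂ) 1‖ ^ 2)

/-- A supercharacter theory `(𝒳, 𝒴)` of a (finite) group `G`. -/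
structure SupercharTheory (G : Type*) [Group G] where
  /-- the partition `𝒳` of `Irr(G)` -/
  parts : Set (Set (IrrChar G))
  /-- the partition `𝒴` of `G`, whose members are the superclasses -/
  classes : Set (Set G)
  parts_isPartition : Setoid.IsPartition parts
  classes_isPartition : Setoid.IsPartition classes
  one_mem_classes : {1} ∈ classes
  encard_eq : parts.encard = classes.encard
  superchar_const : ∀ X ∈ parts, ∀ K ∈ classes, ∀ g ∈ K, ∀ h ∈ K, superchar X g = superchar X h

namespace SupercharTheory

/-- The superclass `Cl_S(g)` containing `g`. -/
def cl {G : Type*} [Group G] (S : SupercharTheory G) (g : G) : Set G :=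
  {k | ∃ K ∈ S.classes, g ∈ K ∧ k ∈ K}

/-- `Irr(S)`: the set of supercharacters `σ_X`, `X ∈ 𝒳`. -/
def irr {G : Type*} [Group G] (S : SupercharTheory G) : Set (G → ℂ) :=
  superchar '' S.parts

/-- `Z(S) = {g ∈ G : |Cl_S(g)| = 1}`. -/
def center {G : Type*} [Group G] (S : SupercharTheory G) : Set G :=
  {g | (S.cl g).ncard = 1}

/-- `[H, S] = ⟨g⁻¹k : g ∈ H, k ∈ Cl_S(g)⟩`. -/
def commutator {G : Type*} [Group G] (S : SupercharTheory G) (H : Subgroup G) : Subgroup G :=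
  Subgroup.closure {x | ∃ g ∈ H, ∃ k ∈ S.cl g, x = g⁻¹ * k}

/-- `Irr(S | N)`: the supercharacters `σ` with `N ⊄ ker σ = {g : σ(g) = σ(1)}`. For `N = [G, S]`
these are the nonlinear supercharacters. -/
def irrOver {G : Type*} [Group G] (S : SupercharTheory G) (N : Subgroup G) : Set (G → ℂ) :=
  {σ | σ ∈ S.irr ∧ ¬ ((N : Set G) ⊆ {g | σ g = σ 1})}

/-- `G` is a `VZ(S)`-group: every member of `Irr(S | [G, S])` vanishes on `G ∖ Z(S)`. -/
def IsVZ {G : Type*} [Group G] (S : SupercharTheory G) : Prop :=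
  ∀ σ ∈ S.irrOver (S.commutator ⊤), ∀ g, g ∉ S.center → σ g = 0

/-- `scd(S) = {σ(1) : σ ∈ Irr(S)}`. -/
def scd {G : Type*} [Group G] (S : SupercharTheory G) : Set ℂ :=
  {d | ∃ σ ∈ S.irr, d = σ 1}

end SupercharTheory

/-!
The functions `G → ℂ` that are constant on superclasses form a space whose dimension is the number
of superclasses. The supercharacters lie in it, are linearly independent by the orthogonality of
irreducible characters, and are equally many, so they span it
(`SupercharTheory.IsSuperclassFun.exists_eq_sum`). In particular superclasses are unions of
conjugacy classes, and pairing with an irreducible character `χ ∈ X` sends a superclass function to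
`a_X χ(1)`, where `a_X` is its coefficient at `σ_X`.

An element `z` lies in `Z(S)` exactly when its indicator function is a superclass function. Such a
`z` is central in `G`, so by Schur's lemma every irreducible representation sends it to a scalar;
pairing the indicator of `z` with the characters in `X` shows that this scalar is the same for all
`χ ∈ X` (`SupercharTheory.exists_superchar_inv_mul`). Hence `σ_X(z⁻¹ h) = c σ_X(h)`, and the space
of superclass functions is stable under translation by `Z(S)`, which makes `Z(S)` a subgroup. It
also gives `σ_X(z) σ_X(z⁻¹) = σ_X(1)²`. If `σ_X` vanishes off `Z(S)`, then
`|G| σ_X(1) = ∑ σ_X(g) σ_X(g⁻¹) = |Z(S)| σ_X(1)²`; since `σ_X(1) = ‖X‖²`, this is the degree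
formula.

If `σ_X` is trivial on `N = [G, S]`, its average over `N` is `∑_{χ ∈ X} χ(1) dim V_χ^N`, and
comparison with `σ_X(1) = ∑_{χ ∈ X} χ(1)²` shows that `N` acts trivially on every `V_χ`. As
superclasses lie in cosets of `N`, each such `χ` is a superclass function, so `X = {χ}`. As
`N` contains the derived subgroup, `χ` is linear, and `σ_X(1) = 1`
(`SupercharTheory.superchar_one_of_subset_ker`).
-/

/-! ### Irreducible representations -/

/-- Schur's lemma: an element whose action commutes with the whole representation acts as a
scalar. -/
theorem Representation.IsIrreducible.exists_eq_smul_one {G V : Type*} [Group G] [AddCommGroup V]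
    [Module ℂ V] [FiniteDimensional ℂ V] {ρ : Representation ℂ G V} (hρ : ρ.IsIrreducible) {z : G}
    (hz : ∀ h, ρ z * ρ h = ρ h * ρ z) : ∃ c : ℂ, ρ z = c • 1 := by
  have := hρ
  let f : Representation.IntertwiningMap ρ ρ := ⟨ρ z, hz⟩
  obtain ⟨c, hc⟩ :=
    (Representation.IsIrreducible.algebraMap_intertwiningMap_bijective_of_isAlgClosed (ρ := ρ)).2 f
  refine ⟨c, ?_⟩
  ext v
  have := congrArg (fun F : Representation.IntertwiningMap ρ ρ => F.toLinearMap v) hc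
  simpa [f, Algebra.algebraMap_eq_smul_one] using this.symm

theorem Representation.IsIrreducible.finrank_pos {G V : Type*} [Group G] [AddCommGroup V]
    [Module ℂ V] [FiniteDimensional ℂ V] {ρ : Representation ℂ G V} (hρ : ρ.IsIrreducible) :
    0 < Module.finrank ℂ V := by
  have := hρ
  have h : IsSimpleModule (MonoidAlgebra ℂ G) ρ.asModule := inferInstance
  have : Nontrivial V := IsSimpleModule.nontrivial (MonoidAlgebra ℂ G) ρ.asModule
  exact Module.finrank_pos

theorem Representation.average_character_subgroup {G V : Type*} [Group G] [AddCommGroup V]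
    [Module ℂ V] [FiniteDimensional ℂ V] (ρ : Representation ℂ G V) (N : Subgroup G) [Fintype N] :
    (Nat.card N : ℂ)⁻¹ * ∑ n : N, ρ.character n =
      Module.finrank ℂ (Representation.invariants (ρ.comp N.subtype)) := by
  have : Invertible (Nat.card N : ℂ) := invertibleOfNonzero (by simp)
  exact Representation.card_inv_mul_sum_char_eq_finrank (ρ.comp N.subtype)

/-! ### Irreducible characters -/

namespace IrrChar

variable {G : Type*} [Group G]

theorem exists_natCast (χ : IrrChar G) : ∃ n : ℕ, 0 < n ∧ (χ : G → ℂ) 1 = n := by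
  obtain ⟨_, V, _, _, _, ρ, hρ, rfl⟩ := χ
  exact ⟨_, hρ.finrank_pos, ρ.char_one⟩

theorem apply_one_ne_zero (χ : IrrChar G) : (χ : G → ℂ) 1 ≠ 0 := by
  obtain ⟨n, hn, h⟩ := exists_natCast χ
  rw [h]
  exact_mod_cast hn.ne'

theorem conj (χ : IrrChar G) (g h : G) : (χ : G → ℂ) (h * g * h⁻¹) = (χ : G → ℂ) g := by
  obtain ⟨_, V, _, _, _, ρ, hρ, rfl⟩ := χ
  exact ρ.char_conj g h

theorem mul_eq_of_mem_center (χ : IrrChar G) {z : G} (hz : ∀ h, z * h = h * z) (h : G) :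
    (χ : G → ℂ) (z * h) * (χ : G → ℂ) 1 = (χ : G → ℂ) z * (χ : G → ℂ) h := by
  obtain ⟨_, V, _, _, _, ρ, hρ, rfl⟩ := χ
  obtain ⟨c, hc⟩ := hρ.exists_eq_smul_one (z := z) fun h => by rw [← map_mul, hz, map_mul]
  simp only [Representation.character, map_mul, hc, map_smul, smul_mul_assoc, one_mul, map_one,
    smul_eq_mul]
  ring

/-- The average of an irreducible character over a subgroup `N` is the dimension of the space of
`N`-invariants. If that is the full degree, then `N` acts trivially, and if moreover `N` contains
the derived subgroup, then the character is linear. -/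
theorem exists_average (χ : IrrChar G) (N : Subgroup G) [Fintype N] :
    ∃ m : ℕ, (Nat.card N : ℂ)⁻¹ * ∑ n : N, (χ : G → ℂ) n = m ∧ (m : ℝ) ≤ ‖(χ : G → ℂ) 1‖ ∧
      ((m : ℝ) = ‖(χ : G → ℂ) 1‖ → (∀ n ∈ N, ∀ g, (χ : G → ℂ) (g * n) = (χ : G → ℂ) g) ∧
        (commutator G ≤ N → (χ : G → ℂ) 1 = 1)) := by
  obtain ⟨_, V, _, _, _, ρ, hρ, rfl⟩ := χ
  refine ⟨_, ρ.average_character_subgroup N, ?_, ?_⟩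
  · simpa using Submodule.finrank_le _
  intro h
  simp only [Representation.char_one, Complex.norm_natCast, Nat.cast_inj] at h
  have htop := Submodule.eq_top_of_finrank_eq h
  have hN : ∀ n ∈ N, ρ n = 1 := fun n hn => by
    ext v
    have hv : v ∈ Representation.invariants (ρ.comp N.subtype) := htop ▸ Submodule.mem_top
    exact hv ⟨n, hn⟩
  refine ⟨fun n hn g => by simp [Representation.character, hN n hn], fun hc => ?_⟩
  have hcomm : ∀ g h, ρ g * ρ h = ρ h * ρ g := fun g h => by
    have h1 := hN (g⁻¹ * h⁻¹ * g * h) (hc (by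
      simpa [_root_.commutator_def, commutatorElement_def] using Subgroup.commutator_mem_commutator
        (Subgroup.mem_top g⁻¹) (Subgroup.mem_top h⁻¹)))
    rw [← map_mul, ← map_mul, show g * h = h * g * (g⁻¹ * h⁻¹ * g * h) by group,
      map_mul ρ (h * g), h1, mul_one]
  -- Every operator `ρ g` is a scalar, so every line is invariant and hence all of `V`.
  have hdim : Module.finrank ℂ V = 1 := by
    have := hρ
    obtain ⟨v, hv⟩ : ∃ v : V, v ≠ 0 := by
      have := Module.finrank_pos_iff.1 hρ.finrank_pos
      exact exists_ne 0
    let W : Subrepresentation ρ := ⟨ℂ ∙ v, fun g w hw => by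
      obtain ⟨c, hc⟩ := hρ.exists_eq_smul_one (hcomm g)
      rw [hc]
      exact Submodule.smul_mem _ c hw⟩
    refine finrank_eq_one v hv fun w => ?_
    have hW : W ≠ ⊥ := fun h => hv <| by
      have h' : v ∈ W.toSubmodule := Submodule.mem_span_singleton_self v
      rw [h] at h'
      exact h'
    have hw : w ∈ W.toSubmodule := by
      rw [(eq_bot_or_eq_top W).resolve_left hW]
      exact Submodule.mem_top
    exact Submodule.mem_span_singleton.1 hw
  exact ρ.char_one.trans (by rw [hdim, Nat.cast_one])

/-- The trivial character. -/
theorem one_mem : (fun _ => 1 : G → ℂ) ∈ IrrChar G := by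
  let ρ : Representation ℂ G ℂ := Representation.trivial ℂ G ℂ
  refine ⟨ℂ, inferInstance, inferInstance, inferInstance, ρ, ?_, ?_⟩
  · have : Nontrivial (Subrepresentation ρ) := ⟨⊥, ⊤, fun h =>
      bot_ne_top (α := Submodule ℂ ℂ) (congrArg Subrepresentation.toSubmodule h)⟩
    exact ⟨fun W => (eq_bot_or_eq_top W.toSubmodule).imp
      (fun h => Subrepresentation.toSubmodule_injective h)
      (fun h => Subrepresentation.toSubmodule_injective h)⟩
  · ext g
    simp [ρ, Representation.character]

/-- The bilinear form `|G|⁻¹ ∑ f(g) ψ(g⁻¹)`; on characters it is the usual inner product. -/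
noncomputable def pairing [Fintype G] (f ψ : G → ℂ) : ℂ :=
  (Nat.card G : ℂ)⁻¹ * ∑ g, f g * ψ g⁻¹

theorem pairing_self [Fintype G] (χ : IrrChar G) : pairing (χ : G → ℂ) χ = 1 := by
  obtain ⟨_, V, _, _, _, ρ, hρ, rfl⟩ := χ
  have : Invertible (Nat.card G : ℂ) := invertibleOfNonzero (by simp)
  have h := Representation.char_orthonormal ρ ρ
  rwa [if_pos ⟨Representation.Equiv.refl ρ⟩] at h

theorem pairing_of_ne [Fintype G] {χ ψ : IrrChar G} (h : χ ≠ ψ) :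
    pairing (χ : G → ℂ) ψ = 0 :=
  (IrrChar.orthonormal χ.2 ψ.2).resolve_left fun h' => h (Subtype.ext h'.2)

theorem pairing_sum [Fintype G] {ι : Type*} (s : Finset ι) (a : ι → ℂ) (f : ι → G → ℂ)
    (ψ : G → ℂ) :
    pairing (fun g => ∑ i ∈ s, a i * f i g) ψ = ∑ i ∈ s, a i * pairing (f i) ψ := by
  simp only [pairing, Finset.sum_mul, Finset.mul_sum]
  rw [Finset.sum_comm]
  exact Finset.sum_congr rfl fun _ _ => Finset.sum_congr rfl fun _ _ => by ring

end IrrChar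

/-! ### The sums `σ_X` -/

section superchar

open IrrChar

variable {G : Type*} [Group G]

theorem superchar_singleton (χ : IrrChar G) (g : G) :
    superchar {χ} g = (χ : G → ℂ) 1 * (χ : G → ℂ) g := by
  simp [superchar]

variable [Finite G]

theorem superchar_eq_sum (X : Set (IrrChar G)) (g : G) :
    superchar X g = ∑ χ ∈ X.toFinite.toFinset, (χ : G → ℂ) 1 * (χ : G → ℂ) g :=
  finsum_mem_eq_finite_toFinset_sum _ _

theorem superchar_conj (X : Set (IrrChar G)) (g h : G) :
    superchar X (h * g * h⁻¹) = superchar X g := by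
  simp only [superchar_eq_sum, IrrChar.conj]

/-- `σ_X(1) = ‖X‖²`. -/
theorem superchar_one (X : Set (IrrChar G)) : superchar X 1 = ((partNorm X ^ 2 : ℝ) : ℂ) := by
  rw [partNorm, finsum_mem_eq_finite_toFinset_sum _ X.toFinite,
    Real.sq_sqrt (Finset.sum_nonneg fun _ _ => by positivity), superchar_eq_sum, Complex.ofReal_sum]
  refine Finset.sum_congr rfl fun χ _ => ?_
  obtain ⟨n, -, h⟩ := exists_natCast χ
  simp [h, sq]

theorem partNorm_pos {X : Set (IrrChar G)} (hX : X.Nonempty) : 0 < partNorm X := by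
  rw [partNorm, finsum_mem_eq_finite_toFinset_sum _ X.toFinite, Real.sqrt_pos]
  refine Finset.sum_pos (fun χ _ => ?_) (by simpa using hX)
  have := norm_pos_iff.2 (apply_one_ne_zero χ)
  positivity

theorem superchar_one_ne_zero {X : Set (IrrChar G)} (hX : X.Nonempty) : superchar X 1 ≠ 0 := by
  rw [superchar_one]
  have := partNorm_pos hX
  exact_mod_cast (by positivity)

theorem pairing_superchar_of_mem [Fintype G] {X : Set (IrrChar G)} {χ : IrrChar G} (h : χ ∈ X) :
    pairing (superchar X) χ = (χ : G → ℂ) 1 := by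
  rw [funext (superchar_eq_sum X), pairing_sum, Finset.sum_eq_single χ, pairing_self, mul_one]
  · intro ψ _ hne
    rw [pairing_of_ne hne, mul_zero]
  · simp [h]

theorem pairing_superchar_of_notMem [Fintype G] {X : Set (IrrChar G)} {χ : IrrChar G}
    (h : χ ∉ X) : pairing (superchar X) χ = 0 := by
  rw [funext (superchar_eq_sum X), pairing_sum]
  refine Finset.sum_eq_zero fun ψ hψ => ?_
  rw [pairing_of_ne, mul_zero]
  rintro rfl
  exact h (by simpa using hψ)

theorem pairing_superchar_self [Fintype G] (X : Set (IrrChar G)) :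
    pairing (superchar X) (superchar X) = superchar X 1 := by
  have : pairing (superchar X) (superchar X) =
      ∑ χ ∈ X.toFinite.toFinset, (χ : G → ℂ) 1 * pairing (superchar X) χ := by
    simp only [pairing]
    simp_rw [superchar_eq_sum X (_⁻¹), Finset.mul_sum]
    rw [Finset.sum_comm]
    exact Finset.sum_congr rfl fun _ _ => Finset.sum_congr rfl fun _ _ => by ring
  rw [this, superchar_eq_sum]
  exact Finset.sum_congr rfl fun χ hχ => by rw [pairing_superchar_of_mem (by simpa using hχ)]

end superchar

/-! ### Superclass functions -/

namespace SupercharTheory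

open IrrChar

variable {G : Type*} [Group G] (S : SupercharTheory G)

/-- A function on `G` that is constant on every superclass. -/
def IsSuperclassFun (f : G → ℂ) : Prop :=
  ∀ K ∈ S.classes, ∀ g ∈ K, ∀ h ∈ K, f g = f h

variable {S}

theorem nonempty_of_mem_parts {X : Set (IrrChar G)} (hX : X ∈ S.parts) : X.Nonempty :=
  Set.nonempty_iff_ne_empty.2 fun h => S.parts_isPartition.1 (h ▸ hX)

theorem eq_of_mem_parts {X Y : Set (IrrChar G)} (hX : X ∈ S.parts) (hY : Y ∈ S.parts)
    {χ : IrrChar G} (h : χ ∈ X) (h' : χ ∈ Y) : X = Y :=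
  (S.parts_isPartition.2 χ).unique ⟨hX, h⟩ ⟨hY, h'⟩

theorem cl_eq_of_mem {K : Set G} (hK : K ∈ S.classes) {g : G} (hg : g ∈ K) : S.cl g = K := by
  ext k
  constructor
  · rintro ⟨L, hL, hgL, hk⟩
    rwa [(S.classes_isPartition.2 g).unique ⟨hK, hg⟩ ⟨hL, hgL⟩]
  · exact fun hk => ⟨K, hK, hg, hk⟩

/-- `Z(S)` consists of the elements whose indicator function is a superclass function. -/
theorem mem_center_iff_isSuperclassFun [DecidableEq G] {z : G} :
    z ∈ S.center ↔ S.IsSuperclassFun (Pi.single z 1) := by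
  obtain ⟨K, ⟨hK, hz⟩, -⟩ := S.classes_isPartition.2 z
  change (S.cl z).ncard = 1 ↔ _
  rw [cl_eq_of_mem hK hz, Set.ncard_eq_one]
  constructor
  · rintro ⟨w, rfl⟩ L hL g hg h hh
    obtain rfl : z = w := hz
    by_cases hzL : z ∈ L
    · obtain rfl := (S.classes_isPartition.2 z).unique ⟨hK, rfl⟩ ⟨hL, hzL⟩
      rw [Set.mem_singleton_iff.1 hg, Set.mem_singleton_iff.1 hh]
    · rw [Pi.single_eq_of_ne (by rintro rfl; exact hzL hg),
        Pi.single_eq_of_ne (by rintro rfl; exact hzL hh)]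
  · refine fun h => ⟨z, Set.eq_singleton_iff_unique_mem.2 ⟨hz, fun k hk => ?_⟩⟩
    by_contra hne
    have := h K hK z hz k hk
    simp [Pi.single_eq_of_ne hne] at this

variable (S) in
theorem one_mem_center : (1 : G) ∈ S.center := by
  change (S.cl 1).ncard = 1
  rw [cl_eq_of_mem S.one_mem_classes rfl, Set.ncard_singleton]

section Finite

variable [Finite G]

/-- Orthogonality makes the supercharacters linearly independent, and there are as many of them as
superclasses, so they span the superclass functions. -/
theorem IsSuperclassFun.exists_eq_sum [Fintype S.parts] {f : G → ℂ} (hf : S.IsSuperclassFun f) :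
    ∃ a : S.parts → ℂ, f = fun g => ∑ X, a X * superchar X.1 g := by
  classical
  have := Fintype.ofFinite G
  have := Fintype.ofFinite S.classes
  have hrep : ∀ K : S.classes, ∃ g, g ∈ K.1 := fun K =>
    Set.nonempty_iff_ne_empty.2 fun h => S.classes_isPartition.1 (h ▸ K.2)
  choose r hr using hrep
  have hext : ∀ f₁ f₂ : G → ℂ, S.IsSuperclassFun f₁ → S.IsSuperclassFun f₂ →
      (∀ K, f₁ (r K) = f₂ (r K)) → f₁ = f₂ := fun f₁ f₂ h₁ h₂ h => funext fun g => by
    obtain ⟨K, ⟨hK, hg⟩, -⟩ := S.classes_isPartition.2 g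
    rw [h₁ K hK g hg _ (hr ⟨K, hK⟩), h, h₂ K hK g hg _ (hr ⟨K, hK⟩)]
  have hsum : ∀ a : S.parts → ℂ, S.IsSuperclassFun fun g => ∑ X, a X * superchar X.1 g :=
    fun a K hK g hg h hh => Finset.sum_congr rfl fun X _ => by
      rw [S.superchar_const X.1 X.2 K hK g hg h hh]
  let v : S.parts → S.classes → ℂ := fun X K => superchar X.1 (r K)
  have hv : LinearIndependent ℂ v := by
    rw [Fintype.linearIndependent_iff]
    intro a ha X
    have h0 : (fun g => ∑ X, a X * superchar X.1 g) = fun _ => 0 :=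
      hext _ _ (hsum a) (fun _ _ _ _ _ _ => rfl) fun K => by simpa [v] using congrFun ha K
    obtain ⟨χ, hχ⟩ := nonempty_of_mem_parts X.2
    have h1 := pairing_sum Finset.univ a (fun X : S.parts => superchar X.1) χ
    rw [h0, Finset.sum_eq_single X, pairing_superchar_of_mem hχ] at h1
    · simpa [pairing, (apply_one_ne_zero χ)] using h1.symm
    · intro Y _ hne
      rw [pairing_superchar_of_notMem, mul_zero]
      exact fun h => hne (Subtype.ext (eq_of_mem_parts Y.2 X.2 h hχ))
    · simp
  have hcard : Fintype.card S.parts = Module.finrank ℂ (S.classes → ℂ) := by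
    rw [Module.finrank_fintype_fun_eq_card, ← Nat.card_eq_fintype_card, ← Nat.card_eq_fintype_card]
    exact congrArg ENat.toNat S.encard_eq
  have hspan := hv.span_eq_top_of_card_eq_finrank' hcard
  obtain ⟨a, ha⟩ := (Submodule.mem_span_range_iff_exists_fun ℂ).1
    (hspan ▸ Submodule.mem_top : (fun K => f (r K)) ∈ Submodule.span ℂ (Set.range v))
  exact ⟨a, hext _ _ hf (hsum a) fun K => by simpa [v] using (congrFun ha K).symm⟩

/-- The pairing of a superclass function with `χ ∈ X` is `χ(1)` times its coefficient at `σ_X`. -/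
theorem IsSuperclassFun.exists_pairing_eq [Fintype G] {f : G → ℂ} (hf : S.IsSuperclassFun f)
    {X : Set (IrrChar G)} (hX : X ∈ S.parts) :
    ∃ c : ℂ, ∀ χ ∈ X, pairing f χ = c * (χ : G → ℂ) 1 := by
  have := Fintype.ofFinite S.parts
  obtain ⟨a, rfl⟩ := hf.exists_eq_sum
  refine ⟨a ⟨X, hX⟩, fun χ hχ => ?_⟩
  rw [pairing_sum Finset.univ a (fun X : S.parts => superchar X.1), Finset.sum_eq_single ⟨X, hX⟩,
    pairing_superchar_of_mem hχ]
  · intro Y _ hne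
    rw [pairing_superchar_of_notMem, mul_zero]
    exact fun h => hne (Subtype.ext (eq_of_mem_parts Y.2 hX h hχ))
  · simp

theorem IsSuperclassFun.conj {f : G → ℂ} (hf : S.IsSuperclassFun f) (g h : G) :
    f (h * g * h⁻¹) = f g := by
  have := Fintype.ofFinite S.parts
  obtain ⟨a, rfl⟩ := hf.exists_eq_sum
  simp only [superchar_conj]

/-- An irreducible character that is a superclass function is a part by itself. -/
theorem eq_singleton_of_isSuperclassFun {X : Set (IrrChar G)} (hX : X ∈ S.parts) {χ : IrrChar G}
    (hχ : χ ∈ X) (hf : S.IsSuperclassFun χ) : X = {χ} := by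
  have := Fintype.ofFinite G
  obtain ⟨c, hc⟩ := hf.exists_pairing_eq hX
  refine Set.eq_singleton_iff_unique_mem.2 ⟨hχ, fun ψ hψ => ?_⟩
  by_contra hne
  have h1 := hc ψ hψ
  have h2 := hc χ hχ
  rw [pairing_of_ne (Ne.symm hne), eq_comm, mul_eq_zero] at h1
  rw [h1.resolve_right (apply_one_ne_zero ψ), zero_mul, pairing_self] at h2
  exact one_ne_zero h2

theorem mem_cl_conj (g h : G) : h * g * h⁻¹ ∈ S.cl g := by
  classical
  obtain ⟨K, ⟨hK, hg⟩, -⟩ := S.classes_isPartition.2 g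
  rw [cl_eq_of_mem hK hg]
  have hind : S.IsSuperclassFun fun x => if x ∈ K then 1 else 0 := fun L hL x hx y hy => by
    rcases eq_or_ne L K with rfl | hne
    · simp [hx, hy]
    · have hL' : ∀ x ∈ L, x ∉ K := fun x hx hxK =>
        hne ((S.classes_isPartition.2 x).unique ⟨hL, hx⟩ ⟨hK, hxK⟩)
      simp [hL' x hx, hL' y hy]
  simpa [hg] using hind.conj g h

theorem commutator_le : _root_.commutator G ≤ S.commutator ⊤ := by
  rw [_root_.commutator_def, Subgroup.commutator_le]
  refine fun g _ h _ => Subgroup.subset_closure ⟨g⁻¹, trivial, _, mem_cl_conj g⁻¹ h, ?_⟩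
  simp [commutatorElement_def, mul_assoc]

/-! ### The center -/

theorem mul_comm_of_mem_center {z : G} (hz : z ∈ S.center) (h : G) : z * h = h * z := by
  classical
  have := (mem_center_iff_isSuperclassFun.1 hz).conj z h
  by_contra hne
  rw [Pi.single_eq_same, Pi.single_eq_of_ne] at this
  · exact zero_ne_one this
  · exact fun h' => hne (mul_inv_eq_iff_eq_mul.1 h').symm

/-- An element of `Z(S)` acts by one and the same scalar on all representations whose characters
belong to a given part. -/
theorem exists_superchar_inv_mul {z : G} (hz : z ∈ S.center) {X : Set (IrrChar G)}
    (hX : X ∈ S.parts) :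
    ∃ c : ℂ, c ≠ 0 ∧ ∀ h, superchar X (z⁻¹ * h) = c * superchar X h := by
  classical
  have := Fintype.ofFinite G
  obtain ⟨a, ha⟩ := (mem_center_iff_isSuperclassFun.1 hz).exists_pairing_eq hX
  have hcard : (Nat.card G : ℂ) ≠ 0 := by simp
  have hz' : ∀ h, z⁻¹ * h = h * z⁻¹ := fun h =>
    ((Commute.inv_left (mul_comm_of_mem_center hz h) : Commute z⁻¹ h)).eq
  have hχ : ∀ χ ∈ X, ∀ h, (χ : G → ℂ) (z⁻¹ * h) = Nat.card G * a * (χ : G → ℂ) h := by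
    intro χ hχ h
    -- The pairing of the indicator of `z` with `χ` is `|G|⁻¹ χ(z⁻¹)`.
    have h1 : (χ : G → ℂ) z⁻¹ = Nat.card G * a * (χ : G → ℂ) 1 := by
      rw [mul_assoc, ← ha χ hχ, pairing, mul_inv_cancel_left₀ hcard, Finset.sum_eq_single z]
      · simp
      · intro g _ hg
        rw [Pi.single_eq_of_ne hg, zero_mul]
      · simp
    have h2 := mul_eq_of_mem_center χ hz' h
    rw [h1] at h2
    exact mul_right_cancel₀ (apply_one_ne_zero χ) (h2.trans (by ring))
  have hσ : ∀ h, superchar X (z⁻¹ * h) = Nat.card G * a * superchar X h := fun h => by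
    simp only [superchar_eq_sum, Finset.mul_sum]
    refine Finset.sum_congr rfl fun χ hm => ?_
    rw [hχ χ (by simpa using hm)]
    ring
  refine ⟨_, fun h0 => superchar_one_ne_zero (nonempty_of_mem_parts hX) ?_, hσ⟩
  rw [← inv_mul_cancel z, hσ, h0, zero_mul]

theorem superchar_mul_superchar_inv {z : G} (hz : z ∈ S.center) {X : Set (IrrChar G)}
    (hX : X ∈ S.parts) : superchar X z * superchar X z⁻¹ = superchar X 1 ^ 2 := by
  obtain ⟨c, -, hc⟩ := exists_superchar_inv_mul hz hX
  have h1 := hc 1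
  have h2 := hc z
  rw [mul_one] at h1
  rw [inv_mul_cancel] at h2
  rw [h1, sq]
  nth_rw 2 [h2]
  ring

theorem IsSuperclassFun.inv_mul {f : G → ℂ} (hf : S.IsSuperclassFun f) {z : G}
    (hz : z ∈ S.center) : S.IsSuperclassFun fun g => f (z⁻¹ * g) := by
  have := Fintype.ofFinite S.parts
  obtain ⟨a, rfl⟩ := hf.exists_eq_sum
  refine fun K hK g hg h hh => Finset.sum_congr rfl fun X _ => ?_
  obtain ⟨c, -, hc⟩ := exists_superchar_inv_mul hz X.2
  rw [hc, hc, S.superchar_const X.1 X.2 K hK g hg h hh]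

theorem IsSuperclassFun.mul {f : G → ℂ} (hf : S.IsSuperclassFun f) {z : G}
    (hz : z ∈ S.center) : S.IsSuperclassFun fun g => f (z * g) := by
  have := Fintype.ofFinite S.parts
  obtain ⟨a, rfl⟩ := hf.exists_eq_sum
  refine fun K hK g hg h hh => Finset.sum_congr rfl fun X _ => ?_
  obtain ⟨c, hc0, hc⟩ := exists_superchar_inv_mul hz X.2
  have h' : ∀ g, superchar X.1 (z * g) = c⁻¹ * superchar X.1 g := fun g => by
    rw [eq_inv_mul_iff_mul_eq₀ hc0, ← hc, inv_mul_cancel_left]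
  rw [h', h', S.superchar_const X.1 X.2 K hK g hg h hh]

variable (S) in
/-- `Z(S)` as a subgroup of `G`. -/
def centerSubgroup : Subgroup G where
  carrier := S.center
  one_mem' := S.one_mem_center
  mul_mem' {z w} hz hw := by
    classical
    -- The indicator of `z * w` is that of `w` translated by `z`.
    rw [mem_center_iff_isSuperclassFun] at hw ⊢
    convert hw.inv_mul hz using 1
    ext g
    simp [Pi.single_apply, inv_mul_eq_iff_eq_mul]
  inv_mem' {z} hz := by
    classical
    have h1 := S.one_mem_center
    -- The indicator of `z⁻¹` is that of `1` translated by `z⁻¹`.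
    rw [mem_center_iff_isSuperclassFun] at h1 ⊢
    convert h1.mul hz using 1
    ext g
    simp [Pi.single_apply, mul_eq_one_iff_eq_inv']

/-! ### Degrees -/

/-- The degree of a supercharacter that vanishes off `Z(S)`. -/
theorem superchar_one_of_vanishing {X : Set (IrrChar G)} (hX : X ∈ S.parts)
    (hv : ∀ g, g ∉ S.center → superchar X g = 0) :
    superchar X 1 = ((partNorm X * Real.sqrt (S.centerSubgroup.index : ℝ) : ℝ) : ℂ) := by
  classical
  have := Fintype.ofFinite G
  have hcard : (Nat.card G : ℂ) ≠ 0 := by simp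
  have hsum : ∑ g, superchar X g * superchar X g⁻¹ =
      Nat.card S.centerSubgroup * superchar X 1 ^ 2 := by
    have : ∀ g, superchar X g * superchar X g⁻¹ =
        if g ∈ S.centerSubgroup then superchar X 1 ^ 2 else 0 := fun g => by
      split_ifs with h
      · exact superchar_mul_superchar_inv h hX
      · rw [hv g h, zero_mul]
    simp_rw [this]
    rw [← Finset.sum_filter, Finset.sum_const, nsmul_eq_mul, Nat.card_eq_fintype_card,
      Fintype.card_subtype]
  have h1 := pairing_superchar_self X
  rw [pairing, hsum, inv_mul_eq_iff_eq_mul₀ hcard, ← S.centerSubgroup.card_mul_index] at h1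
  have hp := partNorm_pos (nonempty_of_mem_parts hX)
  have hZ : (Nat.card S.centerSubgroup : ℝ) ≠ 0 := by simp
  rw [superchar_one] at h1 ⊢
  have h2 : (Nat.card S.centerSubgroup : ℝ) * (partNorm X ^ 2) ^ 2 =
      ((Nat.card S.centerSubgroup * S.centerSubgroup.index : ℕ) : ℝ) * partNorm X ^ 2 := by
    exact_mod_cast h1
  have h3 : (S.centerSubgroup.index : ℝ) = partNorm X ^ 2 := by
    push_cast at h2
    exact mul_left_cancel₀ (mul_ne_zero hZ (pow_ne_zero 2 hp.ne')) (by linarith)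
  rw [h3, Real.sqrt_sq hp.le, sq]

/-- A supercharacter with `[G, S]` in its kernel has degree `1`. -/
theorem superchar_one_of_subset_ker {X : Set (IrrChar G)} (hX : X ∈ S.parts)
    (hker : (S.commutator ⊤ : Set G) ⊆ {g | superchar X g = superchar X 1}) :
    superchar X 1 = 1 := by
  have := Fintype.ofFinite (S.commutator ⊤)
  choose m hm hle heq using fun χ : IrrChar G => exists_average χ (S.commutator ⊤)
  -- Average `σ_X` over `[G, S]`: termwise `m χ ≤ χ(1)`, while the sums weighted by `χ(1)` agree.
  have havg : superchar X 1 = ∑ χ ∈ X.toFinite.toFinset, (χ : G → ℂ) 1 * m χ := by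
    have h1 : (Nat.card (S.commutator ⊤) : ℂ)⁻¹ *
        ∑ n : S.commutator ⊤, superchar X n = superchar X 1 := by
      rw [Finset.sum_congr rfl fun (n : S.commutator ⊤) _ => hker n.2, Finset.sum_const,
        Finset.card_univ, nsmul_eq_mul, ← Nat.card_eq_fintype_card,
        inv_mul_cancel_left₀ (by simp)]
    rw [← h1]
    simp_rw [← hm, superchar_eq_sum X, Finset.mul_sum]
    rw [Finset.sum_comm]
    exact Finset.sum_congr rfl fun _ _ => Finset.sum_congr rfl fun _ _ => by ring
  have hreal : ∑ χ ∈ X.toFinite.toFinset, ‖(χ : G → ℂ) 1‖ * m χ =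
      ∑ χ ∈ X.toFinite.toFinset, ‖(χ : G → ℂ) 1‖ * ‖(χ : G → ℂ) 1‖ := by
    have hn : ∀ χ : IrrChar G, ((‖(χ : G → ℂ) 1‖ : ℝ) : ℂ) = (χ : G → ℂ) 1 := fun χ => by
      obtain ⟨n, -, h⟩ := exists_natCast χ
      simp [h]
    apply Complex.ofReal_injective
    push_cast
    simp_rw [hn]
    rw [← havg, superchar_eq_sum]
  have hall := (Finset.sum_eq_sum_iff_of_le fun χ _ =>
    mul_le_mul_of_nonneg_left (hle χ) (norm_nonneg _)).1 hreal
  obtain ⟨χ, hχ⟩ := nonempty_of_mem_parts hX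
  obtain ⟨htriv, hlin⟩ := heq χ (mul_left_cancel₀ (norm_ne_zero_iff.2 (apply_one_ne_zero χ))
    (hall χ (by simpa using hχ)))
  have hf : S.IsSuperclassFun χ := fun K hK g hg h hh => by
    have := htriv (g⁻¹ * h) (Subgroup.subset_closure ⟨g, trivial, h, ⟨K, hK, hg, hh⟩, rfl⟩) g
    rw [← this, mul_inv_cancel_left]
  rw [eq_singleton_of_isSuperclassFun hX hχ hf, superchar_singleton, hlin commutator_le, one_mul]

theorem exists_mem_parts_superchar_eq_one : ∃ X ∈ S.parts, superchar X = fun _ => 1 := by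
  obtain ⟨X, ⟨hX, hχ⟩, -⟩ := S.parts_isPartition.2 ⟨_, IrrChar.one_mem (G := G)⟩
  refine ⟨X, hX, funext fun g => ?_⟩
  rw [eq_singleton_of_isSuperclassFun hX hχ fun _ _ _ _ _ _ => rfl, superchar_singleton, one_mul]

end Finite

end SupercharTheory

theorem mainTheorem11 {G : Type*} [Group G] [Finite G] (S : SupercharTheory G) (hS : S.IsVZ) :
    ∃ Z : Subgroup G, (Z : Set G) = S.center ∧
      (∀ X ∈ S.parts, superchar X ∈ S.irrOver (S.commutator ⊤) →
        superchar X 1 = ((partNorm X * Real.sqrt (Z.index : ℝ) : ℝ) : ℂ)) ∧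
      S.scd = {1} ∪ {d : ℂ | ∃ X ∈ S.parts, superchar X ∈ S.irrOver (S.commutator ⊤) ∧
        d = ((partNorm X * Real.sqrt (Z.index : ℝ) : ℝ) : ℂ)} := by
  have hdeg : ∀ X ∈ S.parts, superchar X ∈ S.irrOver (S.commutator ⊤) →
      superchar X 1 = ((partNorm X * Real.sqrt (S.centerSubgroup.index : ℝ) : ℝ) : ℂ) :=
    fun X hX h => SupercharTheory.superchar_one_of_vanishing hX (hS _ h)
  refine ⟨S.centerSubgroup, rfl, hdeg, Set.Subset.antisymm ?_ ?_⟩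
  · rintro _ ⟨_, ⟨X, hX, rfl⟩, rfl⟩
    by_cases h : superchar X ∈ S.irrOver (S.commutator ⊤)
    · exact Or.inr ⟨X, hX, h, hdeg X hX h⟩
    · refine Or.inl (SupercharTheory.superchar_one_of_subset_ker hX ?_)
      by_contra hker
      exact h ⟨⟨X, hX, rfl⟩, hker⟩
  · rintro d (rfl | ⟨X, hX, h, rfl⟩)
    · obtain ⟨X, hX, h⟩ := SupercharTheory.exists_mem_parts_superchar_eq_one (S := S)
      exact ⟨_, ⟨X, hX, rfl⟩, by rw [h]⟩
    · exact ⟨_, ⟨X, hX, rfl⟩, (hdeg X hX h).symm⟩
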